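/- **Theorem (advantage of fitting residuals).** *Setting.* Let $x_1,\dots,x_n$ be fixed training locations in a measurable space $X$, let the test location $x\sim\rho$ (a probability measure on $X$) be independent of everything else, let $k\not\equiv 0$ be a kernel on $X$ with $\int k(x,x)\,d\rho(x)<\infty$, and let $\xi_1,\dots,\xi_n$ be i.i.d. $\mathcal N(0,\sigma_n^2)$ with $\sigma_n^2>0$. All random functions below are jointly measurable. *GP learner.* Trained on $\{(x_i,\psi(x_i)+\xi_i)\}_{i=1}^n$, the GP learner chooses a signal variance $\beta\ge 0$ and a noise variance $s>0$ (measurably in the labels) and predicts with the posterior mean $$\bar\psi_{\mathrm{GP}}(x)=\mathbf k_\beta(x)^\top(K_\beta+sI)^{-1}\mathbf y,\qquad \mathbf k_\beta(x)_i=\beta k(x,x_i),\quad (K_\beta)_{ij}=\beta k(x_i,x_j),\quad y_i=\psi(x_i)+\xi_i .$$ Its choice is optimal: if $\psi\sim\mathcal{GP}(0,\beta_0k)$ with $\beta_0>0$, it uses $\beta=\beta_0$ and $s=\sigma_n^2$. For a random function $g$ we say that $g$ is $\varepsilon$-indistinguishable for GP in the presence of $\psi$ if, almost surely, $|\bar\psi_{\mathrm{GP}}(x)-\overline{(\psi+g)}_{\mathrm{GP}}(x)|<\varepsilon$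 for all $x\in X$. *Target and residuals.* Let $f\sim\mathcal{GP}(0,k)$, let $\alpha\in(0,1]$, and let $\sigma_g^2,\delta$ be constants. For every $\varepsilon>0$ let $g$, a predictor $\bar h_{\mathrm{NN}}$, and $r_f,r_g$ be random functions (they may depend on $\varepsilon$) such that * $h=f+g$, where $f$, $g$ and $(\xi_i)_i$ are independent, $g$ is $\varepsilon$-indistinguishable for GP in the presence of $f$, and $\mathbb E[g^2(x)]=\sigma_g^2$; * $h-\bar h_{\mathrm{NN}}=r_f+r_g$, where $r_f\sim\mathcal{GP}(0,\alpha k)$, $r_f$, $r_g$ and $(\xi_i)_i$ are independent, $r_g$ is $\varepsilon$-indistinguishable for GP in the presence of $r_f$, and $\mathbb E[r_g^2(x)]=\sigma_g^2-\delta$. Let $\bar h_{\mathrm{GP}}$ be the GP predictor trained on the labels $y_i=h(x_i)+\xi_i$, and $\bar h_{\mathrm{GP+NN}}=\bar h_{\mathrm{NN}}+\bar r_{\mathrm{GP}}$, where $\bar r_{\mathrm{GP}}$ is the GP predictor trained on the residuals $y_i-\bar h_{\mathrm{NN}}(x_i)$. For $A\in\{\mathrm{GP},\mathrm{NN},\mathrm{GP{+}NN}\}$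 let $E^h_A=\mathbb E[(h(x)-\bar h_A(x))^2]$. *Conclusion.* The three errors are finite. The limit below exists and $$\lim_{\varepsilon\to0^+}\bigl(E^h_{\mathrm{GP}}-E^h_{\mathrm{GP+NN}}\bigr)\ \ge\ \mathbb E[g^2(x)]-\mathbb E[r_g^2(x)]=\delta .$$ If moreover for some $i$ the function $k(\cdot,x_i)$ is not $\rho$-almost everywhere zero, then the limit below exists and $$\lim_{\varepsilon\to0^+}\bigl(E^h_{\mathrm{NN}}-E^h_{\mathrm{GP+NN}}\bigr)\ >\ 0 .$$ -/

import Mathlib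

open MeasureTheory ProbabilityTheory Filter Topology
open scoped NNReal Matrix

noncomputable section

namespace ResidualGP

/-- `ψ ∼ GP(0, k)` under `P`: a centred Gaussian process with covariance kernel `k`. -/
structure IsCenteredGP {X Ω : Type*} [MeasurableSpace Ω] (P : Measure Ω)
    (ψ : X → Ω → ℝ) (k : X → X → ℝ) : Prop where
  gaussian : IsGaussianProcess ψ P
  mean_zero : ∀ x, P[ψ x] = 0
  cov_eq : ∀ x x', cov[ψ x, ψ x'; P] = k x x'

/-- The observation noise: `ξ i`, `i < n`, are i.i.d. with law `N(0, v)`. -/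
structure IsGaussianNoise {Ω : Type*} [MeasurableSpace Ω] (P : Measure Ω) {n : ℕ}
    (ξ : Fin n → Ω → ℝ) (v : ℝ≥0) : Prop where
  law : ∀ i, HasLaw (ξ i) (gaussianReal 0 v) P
  indep : iIndepFun ξ P

/-- The predictive mean `k_*ᵀ (K + s I)⁻¹ y` at `x` of GP regression with kernel `β k` and noise
variance `s`, trained on the labels `y i` at the locations `xs i`. -/
def gpMean {X : Type*} (k : X → X → ℝ) {n : ℕ} (xs : Fin n → X) (β s : ℝ)
    (y : Fin n → ℝ) (x : X) : ℝ :=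
  (fun i => β * k x (xs i)) ⬝ᵥ
    ((Matrix.of (fun i j => β * k (xs i) (xs j)) + s • (1 : Matrix (Fin n) (Fin n) ℝ))⁻¹ *ᵥ y)

/-- A GP learner for kernels of the form `β k`: when it is trained on noisy observations of a
signal `ψ`, it picks the signal variance `β` and the noise variance `s`; the choice may depend on
the signal and on the observed labels. -/
structure GPLearner (X Ω : Type*) (n : ℕ) where
  signalVar : (X → Ω → ℝ) → (Fin n → ℝ) → ℝ
  noiseVar : (X → Ω → ℝ) → (Fin n → ℝ) → ℝ
  measurable_signalVar : ∀ ψ, Measurable (signalVar ψ)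
  measurable_noiseVar : ∀ ψ, Measurable (noiseVar ψ)
  signalVar_nonneg : ∀ ψ y, 0 ≤ signalVar ψ y
  noiseVar_pos : ∀ ψ y, 0 < noiseVar ψ y

/-- The predictor `ψ̄_GP` of the GP learner trained on the data `(xs i, ψ (xs i) + ξ i)`. -/
def GPLearner.predictor {X Ω : Type*} {n : ℕ} (A : GPLearner X Ω n) (k : X → X → ℝ)
    (xs : Fin n → X) (ξ : Fin n → Ω → ℝ) (ψ : X → Ω → ℝ) : X → Ω → ℝ := fun x ω =>
  let y : Fin n → ℝ := fun i => ψ (xs i) ω + ξ i ω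
  gpMean k xs (A.signalVar ψ y) (A.noiseVar ψ y) y x

/-- The learner selects optimal hyperparameters: on a signal that its model describes correctly,
`ψ ∼ GP(0, β k)` with `β > 0` and noise variance `v`, it uses the true values `β` and `v`.
Nothing is required on other signals. -/
def GPLearner.SelectsOptimal {X Ω : Type*} [MeasurableSpace Ω] {n : ℕ} (A : GPLearner X Ω n)
    (P : Measure Ω) (k : X → X → ℝ) (v : ℝ≥0) : Prop :=
  ∀ (ψ : X → Ω → ℝ) (β : ℝ), 0 < β → IsCenteredGP P ψ (fun x x' => β * k x x') →
    ∀ y, A.signalVar ψ y = β ∧ A.noiseVar ψ y = v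

/-- `g` is `ε`-indistinguishable for the GP learner in the presence of the signal `ψ`: almost
surely, the predictors trained on `ψ + ξ` and on `ψ + g + ξ` differ by less than `ε` everywhere. -/
def Indistinguishable {X Ω : Type*} [MeasurableSpace Ω] {n : ℕ} (P : Measure Ω)
    (A : GPLearner X Ω n) (k : X → X → ℝ) (xs : Fin n → X) (ξ : Fin n → Ω → ℝ)
    (ψ g : X → Ω → ℝ) (ε : ℝ) : Prop :=
  ∀ᵐ ω ∂P, ∀ x,
    |A.predictor k xs ξ ψ x ω - A.predictor k xs ξ (fun x ω => ψ x ω + g x ω) x ω| < ε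

/-- The pointwise prediction error, as a function of the test location and of the outcome. -/
def predError {X Ω : Type*} (h hbar : X → Ω → ℝ) : X × Ω → ℝ :=
  fun z => h z.1 z.2 - hbar z.1 z.2

/-- The expected generalization error `E[(h(x) - hbar(x))²]`, for a test location `x ∼ ρ` that is
independent of everything else. -/
def genError {X Ω : Type*} [MeasurableSpace X] [MeasurableSpace Ω] (ρ : Measure X) (P : Measure Ω)
    (h hbar : X → Ω → ℝ) : ℝ :=
  ∫ z, (predError h hbar z) ^ 2 ∂(ρ.prod P)

/-- A component `g` that the GP cannot capture next to the component `φ`: it is square integrable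
with `E[g²(x)] = m`, `φ`, `g` and the noise `ξ` are independent, and `g` is `ε`-indistinguishable
for the GP learner on the data `(xs i, φ (xs i) + g (xs i) + ξ i)`. -/
structure IsApparentNoise {X Ω : Type*} [MeasurableSpace X] [MeasurableSpace Ω] {n : ℕ}
    (ρ : Measure X) (P : Measure Ω) (A : GPLearner X Ω n) (k : X → X → ℝ) (xs : Fin n → X)
    (ξ : Fin n → Ω → ℝ) (φ g : X → Ω → ℝ) (m ε : ℝ) : Prop where
  measurable : Measurable (fun z : X × Ω => g z.1 z.2)
  memLp : MemLp (fun z : X × Ω => g z.1 z.2) 2 (ρ.prod P)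
  second_moment : ∫ z, (g z.1 z.2) ^ 2 ∂(ρ.prod P) = m
  indep_signal : IndepFun (fun ω x => φ x ω) (fun ω x => g x ω) P
  indep_noise : IndepFun (fun ω => ((fun x => φ x ω), (fun x => g x ω))) (fun ω i => ξ i ω) P
  indistinguishable : Indistinguishable P A k xs ξ φ g ε

/-- The sum of two random functions. -/
def addFun {X Ω : Type*} (a b : X → Ω → ℝ) : X → Ω → ℝ := fun x ω => a x ω + b x ω

/-- The predictor `hbarNN + r̄_GP`, where `r̄_GP` is the GP learner trained on the residuals
`y i - hbarNN (xs i)` of the labels `y i = h (xs i) + ξ i`. -/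
def residualPredictor {X Ω : Type*} {n : ℕ} (A : GPLearner X Ω n) (k : X → X → ℝ)
    (xs : Fin n → X) (ξ : Fin n → Ω → ℝ) (h hbarNN : X → Ω → ℝ) : X → Ω → ℝ :=
  addFun hbarNN (A.predictor k xs ξ (fun x ω => h x ω - hbarNN x ω))

end ResidualGP

end

/-! On a pure signal `φ ∼ GP(0, a k)` the optimal hyperparameters are constants, so the GP predictor
is linear in the labels with deterministic weights `w = (K + v I)⁻¹ κ`, formed with the kernel `a
k`. These weights minimise the mean squared error pointwise in the test location; let `M a` be the
minimal risk integrated over `ρ`.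

If apparent noise `g` with second moment `m` is added, the hyperparameters chosen on `φ + g` are
unknown, but the predictor moves by at most `ε`. The error is therefore `W + D`, where `W` is the
linear error on `φ` plus `g`, and `|D| ≤ ε`. The linear error is centred and uncorrelated with `g`,
so `E[W²] = M a + m`, and the generalization error tends to `M a + m`.

Training on residuals is the same situation with signal `r_f` and apparent noise `r_g`. The three
limits are thus `M 1 + sg2` for GP, `M α + (sg2 - δ)` for GP+NN and `∫ α k(x,x) dρ + (sg2 - δ)` for
NN. The weights for `a = 1`, used at `a = α ≤ 1`, shrink the signal part of the risk and keep the
noise part, so `M α ≤ M 1`. Zero weights have risk `α k(x,x)`, and strict convexity makes them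
strictly worse wherever some `k(x, xs i) ≠ 0`. -/

namespace ResidualGP

/-! ### Second moments of the process and of the noise -/

section SecondMoments

variable {X Ω : Type*} [MeasurableSpace Ω] {P : Measure Ω} {φ : X → Ω → ℝ} {κ : X → X → ℝ}

namespace IsCenteredGP

lemma memLp_two (hφ : IsCenteredGP P φ κ) (x : X) : MemLp (φ x) 2 P :=
  (hφ.gaussian.hasGaussianLaw_eval x).memLp_two

lemma symm (hφ : IsCenteredGP P φ κ) (x x' : X) : κ x x' = κ x' x := by
  rw [← hφ.cov_eq, ← hφ.cov_eq, covariance_comm]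

lemma integrable_mul (hφ : IsCenteredGP P φ κ) (x x' : X) :
    Integrable (fun ω => φ x ω * φ x' ω) P :=
  (hφ.memLp_two x).integrable_mul (hφ.memLp_two x')

variable [IsProbabilityMeasure P]

lemma integral_mul (hφ : IsCenteredGP P φ κ) (x x' : X) :
    ∫ ω, φ x ω * φ x' ω ∂P = κ x x' := by
  rw [← hφ.cov_eq x x', covariance_eq_sub (hφ.memLp_two x) (hφ.memLp_two x'), hφ.mean_zero]
  simp

lemma integral_sq (hφ : IsCenteredGP P φ κ) (x : X) : ∫ ω, φ x ω ^ 2 ∂P = κ x x := by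
  simp_rw [← hφ.integral_mul x x, sq]

/-- Cauchy–Schwarz, from the discriminant of `t ↦ E[(φ x + t φ x')²] ≥ 0`. It makes `κ(·, x')`
square integrable once the diagonal is integrable. -/
lemma sq_le (hφ : IsCenteredGP P φ κ) (x x' : X) : κ x x' ^ 2 ≤ κ x x * κ x' x' := by
  have h : ∀ t : ℝ, 0 ≤ κ x' x' * (t * t) + 2 * κ x x' * t + κ x x := by
    intro t
    have h1 := hφ.integrable_mul x x
    have h2 := hφ.integrable_mul x x'
    have h3 := hφ.integrable_mul x' x'
    have h12 : Integrable (fun ω => φ x ω * φ x ω + 2 * t * (φ x ω * φ x' ω)) P :=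
      h1.add (h2.const_mul _)
    have h0 : 0 ≤ ∫ ω, (φ x ω + t * φ x' ω) ^ 2 ∂P := by positivity
    have he : ∀ ω, (φ x ω + t * φ x' ω) ^ 2
        = (φ x ω * φ x ω + 2 * t * (φ x ω * φ x' ω)) + t * t * (φ x' ω * φ x' ω) := by
      intro ω; ring
    simp_rw [he] at h0
    rw [integral_add h12 (h3.const_mul _),
      integral_add h1 (h2.const_mul _), integral_const_mul, integral_const_mul,
      hφ.integral_mul, hφ.integral_mul, hφ.integral_mul] at h0
    linarith
  have := discrim_le_zero h
  rw [discrim] at this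
  nlinarith

end IsCenteredGP

variable {n : ℕ} {ξ : Fin n → Ω → ℝ} {v : ℝ≥0}

namespace IsGaussianNoise

lemma memLp_two (hξ : IsGaussianNoise P ξ v) (i : Fin n) : MemLp (ξ i) 2 P := by
  have h := memLp_id_gaussianReal' (μ := 0) (v := v) 2 (by simp)
  rw [← (hξ.law i).map_eq] at h
  exact h.comp_of_map (hξ.law i).aemeasurable

lemma integral_eq_zero (hξ : IsGaussianNoise P ξ v) (i : Fin n) : ∫ ω, ξ i ω ∂P = 0 := by
  rw [(hξ.law i).integral_eq, integral_id_gaussianReal]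

lemma variance_eq (hξ : IsGaussianNoise P ξ v) (i : Fin n) : Var[ξ i; P] = v := by
  rw [(hξ.law i).variance_eq, variance_id_gaussianReal]

lemma memLp_two_sum (hξ : IsGaussianNoise P ξ v) (u : Fin n → ℝ) :
    MemLp (fun ω => ∑ i, u i * ξ i ω) 2 P :=
  memLp_finsetSum _ fun i _ => (hξ.memLp_two i).const_mul (u i)

variable [IsProbabilityMeasure P]

lemma integral_sum (hξ : IsGaussianNoise P ξ v) (u : Fin n → ℝ) :
    ∫ ω, ∑ i, u i * ξ i ω ∂P = 0 := by
  rw [integral_finsetSum _ fun i _ => ((hξ.memLp_two i).integrable one_le_two).const_mul (u i)]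
  simp [integral_const_mul, hξ.integral_eq_zero]

lemma integral_sq_sum (hξ : IsGaussianNoise P ξ v) (u : Fin n → ℝ) :
    ∫ ω, (∑ i, u i * ξ i ω) ^ 2 ∂P = v * (u ⬝ᵥ u) := by
  rw [← variance_of_integral_eq_zero (hξ.memLp_two_sum u).aemeasurable (hξ.integral_sum u)]
  have h := IndepFun.variance_sum (μ := P) (X := fun i ω => u i * ξ i ω) (s := Finset.univ)
    (fun i _ => (hξ.memLp_two i).const_mul (u i)) (fun i _ j _ hij =>
      (hξ.indep.indepFun hij).comp (measurable_const_mul (u i)) (measurable_const_mul (u j)))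
  have he : (∑ i, fun ω => u i * ξ i ω) = fun ω => ∑ i, u i * ξ i ω := by
    ext ω; simp
  rw [he] at h
  rw [h, dotProduct, Finset.mul_sum]
  refine Finset.sum_congr rfl fun i _ => ?_
  rw [variance_const_mul, hξ.variance_eq]
  ring

end IsGaussianNoise

end SecondMoments

/-! ### The risk as a quadratic form in the weights -/

section Quadratic

variable {X : Type*} {n : ℕ}

/-- The values `κ x (xs i)` of the kernel between the test location and the training locations. -/
def kernelVec (κ : X → X → ℝ) (xs : Fin n → X) (x : X) : Fin n → ℝ := fun i => κ x (xs i)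

/-- The kernel matrix of the training locations. -/
def kernelMatrix (κ : X → X → ℝ) (xs : Fin n → X) : Matrix (Fin n) (Fin n) ℝ :=
  Matrix.of fun i j => κ (xs i) (xs j)

/-- The kernel matrix of the training locations, plus the noise variance on the diagonal. -/
def noisyKernelMatrix (κ : X → X → ℝ) (xs : Fin n → X) (s : ℝ) : Matrix (Fin n) (Fin n) ℝ :=
  kernelMatrix κ xs + s • (1 : Matrix (Fin n) (Fin n) ℝ)

/-- The second moment `E[(φ x - ∑ i, u i * φ (xs i))²]` of a centred process with covariance `κ`. -/
def signalRisk (κ : X → X → ℝ) (xs : Fin n → X) (u : Fin n → ℝ) (x : X) : ℝ :=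
  κ x x - 2 * (u ⬝ᵥ kernelVec κ xs x) + u ⬝ᵥ (kernelMatrix κ xs *ᵥ u)

/-- The risk of the linear predictor with weights `u` from labels with noise variance `s`. -/
def linearRisk (κ : X → X → ℝ) (xs : Fin n → X) (s : ℝ) (u : Fin n → ℝ) (x : X) : ℝ :=
  signalRisk κ xs u x + s * (u ⬝ᵥ u)

/-- The weights of the GP posterior mean at `x`. -/
noncomputable def gpWeights (κ : X → X → ℝ) (xs : Fin n → X) (s : ℝ) (x : X) : Fin n → ℝ :=
  (noisyKernelMatrix κ xs s)⁻¹ *ᵥ kernelVec κ xs x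

lemma linearRisk_eq (κ : X → X → ℝ) (xs : Fin n → X) (s : ℝ) (u : Fin n → ℝ) (x : X) :
    linearRisk κ xs s u x
      = κ x x - 2 * (u ⬝ᵥ kernelVec κ xs x) + u ⬝ᵥ (noisyKernelMatrix κ xs s *ᵥ u) := by
  simp only [linearRisk, signalRisk, noisyKernelMatrix, Matrix.add_mulVec, Matrix.smul_mulVec,
    Matrix.one_mulVec, dotProduct_add, dotProduct_smul, smul_eq_mul]
  ring

lemma linearRisk_zero (κ : X → X → ℝ) (xs : Fin n → X) (s : ℝ) (x : X) :
    linearRisk κ xs s 0 x = κ x x := by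
  simp [linearRisk_eq]

lemma signalRisk_const_mul (k : X → X → ℝ) (xs : Fin n → X) (u : Fin n → ℝ) (x : X) (a : ℝ) :
    signalRisk (fun x x' => a * k x x') xs u x = a * signalRisk k xs u x := by
  have h1 : kernelVec (fun x x' => a * k x x') xs x = a • kernelVec k xs x := rfl
  have h2 : kernelMatrix (fun x x' => a * k x x') xs = a • kernelMatrix k xs := rfl
  simp only [signalRisk, h1, h2, dotProduct_smul, Matrix.smul_mulVec, smul_eq_mul]
  ring

end Quadratic

/-! ### Optimality of the posterior mean weights -/

section GP

variable {X Ω : Type*} [MeasurableSpace Ω] {P : Measure Ω}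
  {φ : X → Ω → ℝ} {κ : X → X → ℝ} {n : ℕ} {xs : Fin n → X} {ξ : Fin n → Ω → ℝ} {v : ℝ≥0}

namespace IsCenteredGP

lemma memLp_two_sum (hφ : IsCenteredGP P φ κ) (xs : Fin n → X) (u : Fin n → ℝ) :
    MemLp (fun ω => ∑ i, u i * φ (xs i) ω) 2 P :=
  memLp_finsetSum _ fun i _ => (hφ.memLp_two (xs i)).const_mul (u i)

lemma transpose_noisyKernelMatrix (hφ : IsCenteredGP P φ κ) (xs : Fin n → X) (s : ℝ) :
    (noisyKernelMatrix κ xs s)ᵀ = noisyKernelMatrix κ xs s := by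
  have : (kernelMatrix κ xs)ᵀ = kernelMatrix κ xs := by
    ext i j; exact hφ.symm _ _
  simp [noisyKernelMatrix, this]

lemma memLp_two_sub_sum (hφ : IsCenteredGP P φ κ) (xs : Fin n → X) (u : Fin n → ℝ) (x : X) :
    MemLp (fun ω => φ x ω - ∑ i, u i * φ (xs i) ω) 2 P :=
  (hφ.memLp_two x).sub (hφ.memLp_two_sum xs u)

/-- Symmetry of the noisy kernel matrix lets its inverse pass from the labels to the kernel vector.
-/
lemma gpMean_eq {k : X → X → ℝ} {β : ℝ} (hφ : IsCenteredGP P φ fun x x' => β * k x x')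
    (xs : Fin n → X) (s : ℝ) (y : Fin n → ℝ) (x : X) :
    gpMean k xs β s y x = ∑ i, gpWeights (fun x x' => β * k x x') xs s x i * y i := by
  change kernelVec (fun x x' => β * k x x') xs x
    ⬝ᵥ ((noisyKernelMatrix (fun x x' => β * k x x') xs s)⁻¹ *ᵥ y) = _ ⬝ᵥ y
  rw [Matrix.dotProduct_mulVec, gpWeights, ← Matrix.mulVec_transpose,
    Matrix.transpose_nonsing_inv, hφ.transpose_noisyKernelMatrix]

variable [IsProbabilityMeasure P]

lemma integral_sum (hφ : IsCenteredGP P φ κ) (xs : Fin n → X) (u : Fin n → ℝ) :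
    ∫ ω, ∑ i, u i * φ (xs i) ω ∂P = 0 := by
  rw [integral_finsetSum _ fun i _ =>
    ((hφ.memLp_two (xs i)).integrable one_le_two).const_mul (u i)]
  simp [integral_const_mul, hφ.mean_zero]

lemma integral_sq_sum (hφ : IsCenteredGP P φ κ) (xs : Fin n → X) (u : Fin n → ℝ) :
    ∫ ω, (∑ i, u i * φ (xs i) ω) ^ 2 ∂P = u ⬝ᵥ (kernelMatrix κ xs *ᵥ u) := by
  have hint : ∀ i j, Integrable (fun ω => u i * u j * (φ (xs i) ω * φ (xs j) ω)) P := fun i j =>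
    (hφ.integrable_mul (xs i) (xs j)).const_mul _
  have he : ∀ ω, (∑ i, u i * φ (xs i) ω) ^ 2
      = ∑ i, ∑ j, u i * u j * (φ (xs i) ω * φ (xs j) ω) := by
    intro ω
    rw [sq, Finset.sum_mul_sum]
    refine Finset.sum_congr rfl fun i _ => Finset.sum_congr rfl fun j _ => by ring
  simp_rw [he]
  rw [integral_finsetSum _ fun i _ => integrable_finsetSum _ fun j _ => hint i j]
  simp only [dotProduct, Matrix.mulVec, kernelMatrix, Matrix.of_apply, Finset.mul_sum]
  refine Finset.sum_congr rfl fun i _ => ?_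
  rw [integral_finsetSum _ fun j _ => hint i j]
  refine Finset.sum_congr rfl fun j _ => ?_
  rw [integral_const_mul, hφ.integral_mul]
  ring

lemma integral_mul_sum (hφ : IsCenteredGP P φ κ) (xs : Fin n → X) (u : Fin n → ℝ) (x : X) :
    ∫ ω, φ x ω * ∑ i, u i * φ (xs i) ω ∂P = u ⬝ᵥ kernelVec κ xs x := by
  have he : ∀ ω, φ x ω * ∑ i, u i * φ (xs i) ω = ∑ i, u i * (φ x ω * φ (xs i) ω) := by
    intro ω
    rw [Finset.mul_sum]
    exact Finset.sum_congr rfl fun i _ => by ring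
  simp_rw [he]
  rw [integral_finsetSum _ fun i _ => (hφ.integrable_mul x (xs i)).const_mul _]
  refine Finset.sum_congr rfl fun i _ => ?_
  rw [integral_const_mul, hφ.integral_mul, kernelVec]

lemma integral_sub_sum (hφ : IsCenteredGP P φ κ) (xs : Fin n → X) (u : Fin n → ℝ) (x : X) :
    ∫ ω, φ x ω - ∑ i, u i * φ (xs i) ω ∂P = 0 := by
  rw [integral_sub ((hφ.memLp_two x).integrable one_le_two)
    ((hφ.memLp_two_sum xs u).integrable one_le_two), hφ.integral_sum, hφ.mean_zero, sub_zero]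

lemma integral_sq_sub_sum (hφ : IsCenteredGP P φ κ) (xs : Fin n → X) (u : Fin n → ℝ) (x : X) :
    ∫ ω, (φ x ω - ∑ i, u i * φ (xs i) ω) ^ 2 ∂P = signalRisk κ xs u x := by
  have he : ∀ ω, (φ x ω - ∑ i, u i * φ (xs i) ω) ^ 2
      = (φ x ω ^ 2 - 2 * (φ x ω * ∑ i, u i * φ (xs i) ω)) + (∑ i, u i * φ (xs i) ω) ^ 2 := by
    intro ω; ring
  have h1 := (hφ.memLp_two x).integrable_sq
  have h2 : Integrable (fun ω => φ x ω * ∑ i, u i * φ (xs i) ω) P :=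
    (hφ.memLp_two x).integrable_mul (hφ.memLp_two_sum xs u)
  have h3 := (hφ.memLp_two_sum xs u).integrable_sq
  have h12 : Integrable (fun ω => φ x ω ^ 2 - 2 * (φ x ω * ∑ i, u i * φ (xs i) ω)) P :=
    h1.sub (h2.const_mul 2)
  simp_rw [he]
  rw [integral_add h12 h3, integral_sub h1 (h2.const_mul 2),
    integral_const_mul, hφ.integral_sq, hφ.integral_mul_sum, hφ.integral_sq_sum, signalRisk]

lemma signalRisk_nonneg (hφ : IsCenteredGP P φ κ) (xs : Fin n → X) (u : Fin n → ℝ) (x : X) :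
    0 ≤ signalRisk κ xs u x := by
  rw [← hφ.integral_sq_sub_sum]; positivity

lemma dotProduct_kernelMatrix_nonneg (hφ : IsCenteredGP P φ κ) (xs : Fin n → X)
    (u : Fin n → ℝ) : 0 ≤ u ⬝ᵥ (kernelMatrix κ xs *ᵥ u) := by
  rw [← hφ.integral_sq_sum]; positivity

lemma mul_dotProduct_le (hφ : IsCenteredGP P φ κ) (xs : Fin n → X) (s : ℝ) (u : Fin n → ℝ) :
    s * (u ⬝ᵥ u) ≤ u ⬝ᵥ (noisyKernelMatrix κ xs s *ᵥ u) := by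
  have := hφ.dotProduct_kernelMatrix_nonneg xs u
  simp only [noisyKernelMatrix, Matrix.add_mulVec, Matrix.smul_mulVec,
    Matrix.one_mulVec, dotProduct_add, dotProduct_smul, smul_eq_mul]
  linarith

lemma posDef_noisyKernelMatrix (hφ : IsCenteredGP P φ κ) (xs : Fin n → X) {s : ℝ} (hs : 0 < s) :
    (noisyKernelMatrix κ xs s).PosDef := by
  refine Matrix.PosDef.of_dotProduct_mulVec_pos ?_ fun u hu => ?_
  · rw [Matrix.IsHermitian, Matrix.conjTranspose_eq_transpose_of_trivial,
      hφ.transpose_noisyKernelMatrix]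
  · refine lt_of_lt_of_le ?_ (hφ.mul_dotProduct_le xs s u)
    have : 0 < u ⬝ᵥ u := by simpa using Matrix.dotProduct_star_self_pos_iff.2 hu
    positivity

lemma noisyKernelMatrix_mulVec_gpWeights (hφ : IsCenteredGP P φ κ) (xs : Fin n → X) {s : ℝ}
    (hs : 0 < s) (x : X) :
    noisyKernelMatrix κ xs s *ᵥ gpWeights κ xs s x = kernelVec κ xs x := by
  have h := (Matrix.isUnit_iff_isUnit_det _).1 (hφ.posDef_noisyKernelMatrix xs hs).isUnit
  rw [gpWeights, Matrix.mulVec_mulVec, Matrix.mul_nonsing_inv _ h, Matrix.one_mulVec]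

/-- Completing the square: the linear term disappears because the weights solve `M w = κ` with `M`
symmetric. -/
lemma linearRisk_eq_add (hφ : IsCenteredGP P φ κ) (xs : Fin n → X) {s : ℝ} (hs : 0 < s)
    (u : Fin n → ℝ) (x : X) :
    linearRisk κ xs s u x = linearRisk κ xs s (gpWeights κ xs s x) x
      + (u - gpWeights κ xs s x) ⬝ᵥ (noisyKernelMatrix κ xs s *ᵥ (u - gpWeights κ xs s x)) := by
  rw [linearRisk_eq, linearRisk_eq, ← hφ.noisyKernelMatrix_mulVec_gpWeights xs hs x]
  set w := gpWeights κ xs s x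
  set M := noisyKernelMatrix κ xs s with hM
  have hsym : w ⬝ᵥ (M *ᵥ u) = u ⬝ᵥ (M *ᵥ w) := by
    have h := Matrix.dotProduct_transpose_mulVec M w u
    rwa [hM, hφ.transpose_noisyKernelMatrix, ← hM] at h
  simp only [Matrix.mulVec_sub, dotProduct_sub, sub_dotProduct, hsym]
  ring

lemma linearRisk_gpWeights_le (hφ : IsCenteredGP P φ κ) (xs : Fin n → X) {s : ℝ} (hs : 0 < s)
    (u : Fin n → ℝ) (x : X) :
    linearRisk κ xs s (gpWeights κ xs s x) x ≤ linearRisk κ xs s u x := by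
  rw [hφ.linearRisk_eq_add xs hs u x, le_add_iff_nonneg_right]
  refine le_trans ?_ (hφ.mul_dotProduct_le xs s _)
  exact mul_nonneg hs.le (by simpa using dotProduct_star_self_nonneg (u - gpWeights κ xs s x))

/-- The gap to zero weights is `wᵀ M w` with `M` positive definite. It vanishes only for `w = 0`,
which would force the kernel vector `M w` to be zero. -/
lemma linearRisk_gpWeights_lt (hφ : IsCenteredGP P φ κ) (xs : Fin n → X) {s : ℝ} (hs : 0 < s)
    {x : X} {i : Fin n} (hi : κ x (xs i) ≠ 0) :
    linearRisk κ xs s (gpWeights κ xs s x) x < κ x x := by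
  rw [← linearRisk_zero κ xs s x, hφ.linearRisk_eq_add xs hs 0 x, lt_add_iff_pos_right]
  refine (hφ.posDef_noisyKernelMatrix xs hs).dotProduct_mulVec_pos
    (x := 0 - gpWeights κ xs s x) fun h => hi ?_
  have h' : gpWeights κ xs s x = 0 := by rwa [zero_sub, neg_eq_zero] at h
  have := hφ.noisyKernelMatrix_mulVec_gpWeights xs hs x
  rw [h', Matrix.mulVec_zero] at this
  exact (congrFun this i).symm

end IsCenteredGP

end GP

/-! ### Errors of linear predictors at a fixed test location -/

section LinearPrediction

variable {X Ω : Type*} [MeasurableSpace Ω] {P : Measure Ω} [IsProbabilityMeasure P]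
  {φ : X → Ω → ℝ} {κ : X → X → ℝ} {n : ℕ} {xs : Fin n → X} {ξ : Fin n → Ω → ℝ} {v : ℝ≥0}

lemma integral_sq_linearError (hφ : IsCenteredGP P φ κ) (hξ : IsGaussianNoise P ξ v)
    (hind : IndepFun (fun ω x => φ x ω) (fun ω i => ξ i ω) P)
    (xs : Fin n → X) (u : Fin n → ℝ) (x : X) :
    ∫ ω, (φ x ω - ∑ i, u i * (φ (xs i) ω + ξ i ω)) ^ 2 ∂P = linearRisk κ xs v u x := by
  have hT := hφ.memLp_two_sub_sum xs u x
  have hN := hξ.memLp_two_sum u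
  have hTN : IndepFun (fun ω => φ x ω - ∑ i, u i * φ (xs i) ω) (fun ω => ∑ i, u i * ξ i ω) P :=
    hind.comp (φ := fun y : X → ℝ => y x - ∑ i, u i * y (xs i))
      (ψ := fun y : Fin n → ℝ => ∑ i, u i * y i) (by fun_prop) (by fun_prop)
  have he : ∀ ω, (φ x ω - ∑ i, u i * (φ (xs i) ω + ξ i ω)) ^ 2
      = ((φ x ω - ∑ i, u i * φ (xs i) ω) ^ 2
        - 2 * ((φ x ω - ∑ i, u i * φ (xs i) ω) * ∑ i, u i * ξ i ω))
        + (∑ i, u i * ξ i ω) ^ 2 := by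
    intro ω
    simp only [mul_add, Finset.sum_add_distrib]
    ring
  have h2 : Integrable
      (fun ω => (φ x ω - ∑ i, u i * φ (xs i) ω) * ∑ i, u i * ξ i ω) P := hT.integrable_mul hN
  have h12 : Integrable (fun ω => (φ x ω - ∑ i, u i * φ (xs i) ω) ^ 2
      - 2 * ((φ x ω - ∑ i, u i * φ (xs i) ω) * ∑ i, u i * ξ i ω)) P :=
    hT.integrable_sq.sub (h2.const_mul 2)
  simp_rw [he]
  rw [integral_add h12 hN.integrable_sq, integral_sub hT.integrable_sq (h2.const_mul 2),
    integral_const_mul, hTN.integral_fun_mul_eq_mul_integral hT.1 hN.1, hφ.integral_sq_sub_sum,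
    hξ.integral_sum, hξ.integral_sq_sum, linearRisk]
  ring

/-- The error splits into a signal part and a noise part, each centred and independent of `g`. Hence
`g` itself need not be centred. -/
lemma integral_linearError_mul (hφ : IsCenteredGP P φ κ) (hξ : IsGaussianNoise P ξ v)
    {g : X → Ω → ℝ} (hg : IndepFun (fun ω x => φ x ω) (fun ω x => g x ω) P)
    (hgξ : IndepFun (fun ω x => g x ω) (fun ω i => ξ i ω) P)
    (xs : Fin n → X) (u : Fin n → ℝ) (x : X) (hgx : Integrable (g x) P) :
    ∫ ω, (φ x ω - ∑ i, u i * (φ (xs i) ω + ξ i ω)) * g x ω ∂P = 0 := by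
  have hT := hφ.memLp_two_sub_sum xs u x
  have hN := hξ.memLp_two_sum u
  have hTg : IndepFun (fun ω => φ x ω - ∑ i, u i * φ (xs i) ω) (g x) P :=
    hg.comp (φ := fun y : X → ℝ => y x - ∑ i, u i * y (xs i))
      (ψ := fun y : X → ℝ => y x) (by fun_prop) (by fun_prop)
  have hNg : IndepFun (fun ω => ∑ i, u i * ξ i ω) (g x) P :=
    (hgξ.comp (φ := fun y : X → ℝ => y x) (ψ := fun y : Fin n → ℝ => ∑ i, u i * y i)
      (by fun_prop) (by fun_prop)).symm
  have he : ∀ ω, (φ x ω - ∑ i, u i * (φ (xs i) ω + ξ i ω)) * g x ω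
      = (φ x ω - ∑ i, u i * φ (xs i) ω) * g x ω - (∑ i, u i * ξ i ω) * g x ω := by
    intro ω
    simp only [mul_add, Finset.sum_add_distrib]
    ring
  simp_rw [he]
  have h1 : Integrable (fun ω => (φ x ω - ∑ i, u i * φ (xs i) ω) * g x ω) P :=
    hTg.integrable_mul (hT.integrable one_le_two) hgx
  have h2 : Integrable (fun ω => (∑ i, u i * ξ i ω) * g x ω) P :=
    hNg.integrable_mul (hN.integrable one_le_two) hgx
  rw [integral_sub h1 h2, hTg.integral_fun_mul_eq_mul_integral hT.1 hgx.1,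
    hNg.integral_fun_mul_eq_mul_integral hN.1 hgx.1, hφ.integral_sub_sum, hξ.integral_sum]
  simp

end LinearPrediction

/-! ### Averaging over the test location -/

section Product

variable {X Ω : Type*} [MeasurableSpace X] [MeasurableSpace Ω] {ρ : Measure X} {P : Measure Ω}

lemma memLp_two_mul_prod [SFinite ρ] [SFinite P] {a : X → ℝ} {b : Ω → ℝ} (ha : MemLp a 2 ρ)
    (hb : MemLp b 2 P) : MemLp (fun z : X × Ω => a z.1 * b z.2) 2 (ρ.prod P) := by
  refine (memLp_two_iff_integrable_sq (ha.1.comp_fst.mul hb.1.comp_snd)).2 ?_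
  simpa only [Pi.mul_apply, mul_pow] using ha.integrable_sq.mul_prod hb.integrable_sq

variable [IsProbabilityMeasure P]
  {φ : X → Ω → ℝ} {κ : X → X → ℝ} {n : ℕ} {xs : Fin n → X} {ξ : Fin n → Ω → ℝ} {v : ℝ≥0}

/-- Measurability of the kernel is inherited from the process through `κ x x' = E[φ x φ x']`. -/
lemma IsCenteredGP.measurable_kernel (hφ : IsCenteredGP P φ κ)
    (hφm : Measurable fun z : X × Ω => φ z.1 z.2) (x' : X) : Measurable fun x => κ x x' := by
  simp_rw [← hφ.integral_mul]
  have : Measurable fun z : X × Ω => φ z.1 z.2 * φ x' z.2 :=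
    hφm.mul ((hφm.comp measurable_prodMk_left).comp measurable_snd)
  exact this.stronglyMeasurable.integral_prod_right.measurable

lemma IsCenteredGP.memLp_kernel (hφ : IsCenteredGP P φ κ)
    (hφm : Measurable fun z : X × Ω => φ z.1 z.2) (hκ : Integrable (fun x => κ x x) ρ) (x' : X) :
    MemLp (fun x => κ x x') 2 ρ := by
  have hm := hφ.measurable_kernel hφm x'
  refine (memLp_two_iff_integrable_sq hm.aestronglyMeasurable).2 ?_
  refine (hκ.mul_const (κ x' x')).mono' (hm.pow_const 2).aestronglyMeasurable ?_
  refine Eventually.of_forall fun x => ?_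
  rw [Real.norm_of_nonneg (sq_nonneg _)]
  exact hφ.sq_le x x'

lemma IsCenteredGP.memLp_gpWeights (hφ : IsCenteredGP P φ κ)
    (hφm : Measurable fun z : X × Ω => φ z.1 z.2) (hκ : Integrable (fun x => κ x x) ρ)
    (xs : Fin n → X) (s : ℝ) (i : Fin n) :
    MemLp (fun x => gpWeights κ xs s x i) 2 ρ :=
  memLp_finsetSum Finset.univ fun j _ =>
    (hφ.memLp_kernel hφm hκ (xs j)).const_mul ((noisyKernelMatrix κ xs s)⁻¹ i j)

lemma IsCenteredGP.memLp_uncurry [SFinite ρ] (hφ : IsCenteredGP P φ κ)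
    (hφm : Measurable fun z : X × Ω => φ z.1 z.2) (hκ : Integrable (fun x => κ x x) ρ) :
    MemLp (fun z : X × Ω => φ z.1 z.2) 2 (ρ.prod P) := by
  refine (memLp_two_iff_integrable_sq hφm.aestronglyMeasurable).2 ?_
  refine (integrable_prod_iff (hφm.pow_const 2).aestronglyMeasurable).2
    ⟨Eventually.of_forall fun x => (hφ.memLp_two x).integrable_sq, ?_⟩
  simpa [hφ.integral_sq] using hκ

/-- The error on the signal `φ` of a linear predictor with weights `u`. -/
def linearError (xs : Fin n → X) (ξ : Fin n → Ω → ℝ) (φ : X → Ω → ℝ) (u : X → Fin n → ℝ) :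
    X × Ω → ℝ :=
  fun z => φ z.1 z.2 - ∑ i, u z.1 i * (φ (xs i) z.2 + ξ i z.2)

variable [IsProbabilityMeasure ρ]

lemma memLp_linearError (hφ : IsCenteredGP P φ κ) (hξ : IsGaussianNoise P ξ v)
    (hφm : Measurable fun z : X × Ω => φ z.1 z.2) (hκ : Integrable (fun x => κ x x) ρ)
    {u : X → Fin n → ℝ} (hu : ∀ i, MemLp (fun x => u x i) 2 ρ) :
    MemLp (linearError xs ξ φ u) 2 (ρ.prod P) :=
  (hφ.memLp_uncurry hφm hκ).sub (memLp_finsetSum _ fun i _ =>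
    memLp_two_mul_prod (hu i) ((hφ.memLp_two (xs i)).add (hξ.memLp_two i)))

lemma integrable_linearRisk (hφ : IsCenteredGP P φ κ) (hξ : IsGaussianNoise P ξ v)
    (hind : IndepFun (fun ω x => φ x ω) (fun ω i => ξ i ω) P)
    (hφm : Measurable fun z : X × Ω => φ z.1 z.2) (hκ : Integrable (fun x => κ x x) ρ)
    {u : X → Fin n → ℝ} (hu : ∀ i, MemLp (fun x => u x i) 2 ρ) :
    Integrable (fun x => linearRisk κ xs v (u x) x) ρ := by
  have h := (memLp_linearError (xs := xs) hφ hξ hφm hκ hu).integrable_sq.integral_prod_left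
  simpa only [linearError, integral_sq_linearError hφ hξ hind] using h

/-- The mean squared error of a linear predictor of `φ` on the target `φ + g`: the component `g`,
which is independent of `φ` and of the noise, adds its second moment. -/
lemma integral_sq_linearError_add (hφ : IsCenteredGP P φ κ) (hξ : IsGaussianNoise P ξ v)
    (hind : IndepFun (fun ω x => φ x ω) (fun ω i => ξ i ω) P)
    (hφm : Measurable fun z : X × Ω => φ z.1 z.2) (hκ : Integrable (fun x => κ x x) ρ)
    {u : X → Fin n → ℝ} (hu : ∀ i, MemLp (fun x => u x i) 2 ρ)
    {g : X → Ω → ℝ} (hg2 : MemLp (fun z : X × Ω => g z.1 z.2) 2 (ρ.prod P))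
    (hg : IndepFun (fun ω x => φ x ω) (fun ω x => g x ω) P)
    (hgξ : IndepFun (fun ω x => g x ω) (fun ω i => ξ i ω) P) :
    ∫ z, (linearError xs ξ φ u z + g z.1 z.2) ^ 2 ∂(ρ.prod P)
      = ∫ x, linearRisk κ xs v (u x) x ∂ρ + ∫ z, g z.1 z.2 ^ 2 ∂(ρ.prod P) := by
  have hZ := memLp_linearError (xs := xs) hφ hξ hφm hκ hu
  have hZg : Integrable (fun z : X × Ω => linearError xs ξ φ u z * g z.1 z.2) (ρ.prod P) :=
    hZ.integrable_mul hg2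
  have he : ∀ z : X × Ω, (linearError xs ξ φ u z + g z.1 z.2) ^ 2
      = (linearError xs ξ φ u z ^ 2 + 2 * (linearError xs ξ φ u z * g z.1 z.2))
        + g z.1 z.2 ^ 2 := by
    intro z; ring
  have h12 : Integrable (fun z : X × Ω => linearError xs ξ φ u z ^ 2
      + 2 * (linearError xs ξ φ u z * g z.1 z.2)) (ρ.prod P) :=
    hZ.integrable_sq.add (hZg.const_mul 2)
  have hcross : ∫ z : X × Ω, linearError xs ξ φ u z * g z.1 z.2 ∂(ρ.prod P) = 0 := by
    rw [integral_prod _ hZg]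
    refine integral_eq_zero_of_ae ?_
    filter_upwards [(hg2.integrable one_le_two).prod_right_ae] with x hx
    exact integral_linearError_mul hφ hξ hg hgξ xs (u x) x hx
  simp_rw [he]
  rw [integral_add h12 hg2.integrable_sq, integral_add hZ.integrable_sq (hZg.const_mul 2),
    integral_const_mul, hcross, integral_prod _ hZ.integrable_sq]
  simp only [linearError, integral_sq_linearError hφ hξ hind, mul_zero, add_zero]

end Product

/-! ### Measurability with label-dependent hyperparameters -/

section Measurability

variable {X Z : Type*} [MeasurableSpace Z] {n : ℕ}

/-- The inverse is `det⁻¹` times the adjugate, with `0⁻¹ = 0` on singular matrices, so no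
invertibility is needed. -/
lemma aemeasurable_inv_entry {μ : Measure Z} (K : Matrix (Fin n) (Fin n) ℝ) {β s : Z → ℝ}
    (hβ : AEMeasurable β μ) (hs : AEMeasurable s μ) (i j : Fin n) :
    AEMeasurable (fun z => (β z • K + s z • (1 : Matrix (Fin n) (Fin n) ℝ))⁻¹ i j) μ := by
  have hc : Continuous fun p : ℝ × ℝ => p.1 • K + p.2 • (1 : Matrix (Fin n) (Fin n) ℝ) := by
    fun_prop
  have hdet := hc.matrix_det.measurable.inv
  have hadj := (hc.matrix_adjugate.matrix_elem i j).measurable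
  simp only [Matrix.inv_def, Matrix.smul_apply, smul_eq_mul, Ring.inverse_eq_inv']
  exact (hdet.mul hadj).comp_aemeasurable (hβ.prodMk hs)

lemma aemeasurable_gpMean {μ : Measure Z} (k : X → X → ℝ) (xs : Fin n → X) {β s : Z → ℝ}
    {y : Z → Fin n → ℝ} {x : Z → X} (hβ : AEMeasurable β μ) (hs : AEMeasurable s μ)
    (hy : ∀ i, AEMeasurable (fun z => y z i) μ)
    (hk : ∀ i, AEMeasurable (fun z => k (x z) (xs i)) μ) :
    AEMeasurable (fun z => gpMean k xs (β z) (s z) (y z) (x z)) μ := by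
  have he : ∀ z, gpMean k xs (β z) (s z) (y z) (x z) = ∑ i, β z * k (x z) (xs i)
      * ∑ j, (β z • kernelMatrix k xs + s z • (1 : Matrix (Fin n) (Fin n) ℝ))⁻¹ i j * y z j :=
    fun z => rfl
  simp only [he]
  exact Finset.aemeasurable_fun_sum _ fun i _ => (hβ.mul (hk i)).mul
    (Finset.aemeasurable_fun_sum _ fun j _ => (aemeasurable_inv_entry (kernelMatrix k xs) hβ hs i j).mul (hy j))

end Measurability

/-! ### Stability of the squared error under small perturbations -/

section Perturbation

variable {Z : Type*} [MeasurableSpace Z] {μ : Measure Z} [IsProbabilityMeasure μ]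

/-- Pointwise, `|(W + D)² - W²| ≤ 2 ε |W| + ε² ≤ ε (1 + W²) + ε²`. Only the second moment of `W`
enters, so the bound is uniform over families sharing it. -/
lemma abs_integral_sq_add_sub_le {W D : Z → ℝ} {ε : ℝ} (hW : MemLp W 2 μ)
    (hD : AEStronglyMeasurable D μ) (hDε : ∀ᵐ z ∂μ, |D z| ≤ ε) :
    |∫ z, (W z + D z) ^ 2 ∂μ - ∫ z, W z ^ 2 ∂μ| ≤ ε * (1 + ∫ z, W z ^ 2 ∂μ) + ε ^ 2 := by
  have hD2 : MemLp D 2 μ := MemLp.of_bound hD ε hDε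
  have hWD : Integrable (fun z => (W z + D z) ^ 2) μ := (hW.add hD2).integrable_sq
  have hW2 := hW.integrable_sq
  rw [← integral_sub hWD hW2]
  have hb : Integrable (fun z => ε * W z ^ 2 + (ε + ε ^ 2)) μ :=
    (hW2.const_mul ε).add (integrable_const _)
  have hle : ∫ z, ε * W z ^ 2 + (ε + ε ^ 2) ∂μ = ε * (1 + ∫ z, W z ^ 2 ∂μ) + ε ^ 2 := by
    rw [integral_add (hW2.const_mul ε) (integrable_const _), integral_const_mul]
    simp
    ring
  rw [← hle, ← Real.norm_eq_abs]
  refine norm_integral_le_of_norm_le hb ?_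
  filter_upwards [hDε] with z hz
  have h1 : 2 * |W z| ≤ 1 + W z ^ 2 := by
    nlinarith [sq_nonneg (|W z| - 1), sq_abs (W z)]
  have h2 : |W z * D z| ≤ |W z| * ε := by
    rw [abs_mul]; gcongr
  have h3 : D z ^ 2 ≤ ε ^ 2 := by
    rw [← sq_abs]; gcongr
  have hε : 0 ≤ ε := (abs_nonneg _).trans hz
  have h4 : |W z| * ε * 2 ≤ (1 + W z ^ 2) * ε := by nlinarith
  rw [Real.norm_eq_abs, abs_le]
  have := abs_le.1 h2
  constructor <;> nlinarith [sq_nonneg (D z)]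

lemma tendsto_of_abs_sub_le {F : ℝ → ℝ} {S : ℝ}
    (h : ∀ ε > 0, |F ε - S| ≤ ε * (1 + S) + ε ^ 2) : Tendsto F (𝓝[>] 0) (𝓝 S) := by
  have h0 : Tendsto (fun ε : ℝ => ε * (1 + S) + ε ^ 2) (𝓝[>] 0) (𝓝 0) := by
    have : Continuous fun ε : ℝ => ε * (1 + S) + ε ^ 2 := by fun_prop
    simpa using (this.tendsto 0).mono_left nhdsWithin_le_nhds
  refine tendsto_iff_norm_sub_tendsto_zero.2 (squeeze_zero' (Eventually.of_forall fun _ =>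
    norm_nonneg _) ?_ h0)
  filter_upwards [self_mem_nhdsWithin] with ε hε using h ε hε

end Perturbation

/-! ### The GP learner in the presence of apparent noise -/

section Learner

lemma GPLearner.SelectsOptimal.predictor_eq {X Ω : Type*} [MeasurableSpace Ω] {P : Measure Ω}
    {n : ℕ} {xs : Fin n → X} {k : X → X → ℝ} {v : ℝ≥0} {ξ : Fin n → Ω → ℝ} {A : GPLearner X Ω n}
    {φ : X → Ω → ℝ} {a : ℝ} (hA : A.SelectsOptimal P k v) (ha : 0 < a)
    (hφ : IsCenteredGP P φ fun x x' => a * k x x') (x : X) (ω : Ω) :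
    A.predictor k xs ξ φ x ω
      = ∑ i, gpWeights (fun x x' => a * k x x') xs v x i * (φ (xs i) ω + ξ i ω) := by
  have h := hA φ a ha hφ fun i => φ (xs i) ω + ξ i ω
  simp only [GPLearner.predictor, h.1, h.2]
  exact hφ.gpMean_eq xs v _ x

variable {X Ω : Type*} [MeasurableSpace X] [MeasurableSpace Ω] {ρ : Measure X}
  {P : Measure Ω} {n : ℕ} {xs : Fin n → X}
  {k : X → X → ℝ} {v : ℝ≥0} {ξ : Fin n → Ω → ℝ} {A : GPLearner X Ω n} {φ g : X → Ω → ℝ}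
  {a m ε : ℝ}

lemma GPLearner.aemeasurable_predictor [SFinite ρ] [SFinite P]
    (A : GPLearner X Ω n) (hξ : IsGaussianNoise P ξ v)
    (hk : ∀ x', Measurable fun x => k x x') {ψ : X → Ω → ℝ} (hψ : ∀ x, Measurable (ψ x)) :
    AEMeasurable (fun z : X × Ω => A.predictor k xs ξ ψ z.1 z.2) (ρ.prod P) := by
  have hy : ∀ i, AEMeasurable (fun z : X × Ω => ψ (xs i) z.2 + ξ i z.2) (ρ.prod P) := fun i =>
    ((hψ (xs i)).comp measurable_snd).aemeasurable.add (hξ.law i).aemeasurable.comp_snd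
  have hy' := aemeasurable_pi_iff.2 hy
  exact aemeasurable_gpMean k xs ((A.measurable_signalVar ψ).comp_aemeasurable hy')
    ((A.measurable_noiseVar ψ).comp_aemeasurable hy') hy
    fun i => ((hk (xs i)).comp measurable_fst).aemeasurable

namespace IsApparentNoise

lemma indepFun_signal_noise (hg : IsApparentNoise ρ P A k xs ξ φ g m ε) :
    IndepFun (fun ω x => φ x ω) (fun ω i => ξ i ω) P :=
  hg.indep_noise.comp measurable_fst measurable_id

lemma indepFun_noise (hg : IsApparentNoise ρ P A k xs ξ φ g m ε) :
    IndepFun (fun ω x => g x ω) (fun ω i => ξ i ω) P :=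
  hg.indep_noise.comp measurable_snd measurable_id

variable [IsProbabilityMeasure ρ] [IsProbabilityMeasure P]

lemma memLp_addFun (hg : IsApparentNoise ρ P A k xs ξ φ g m ε)
    (hφ : IsCenteredGP P φ fun x x' => a * k x x') (hφm : Measurable fun z : X × Ω => φ z.1 z.2)
    (hκ : Integrable (fun x => a * k x x) ρ) :
    MemLp (fun z : X × Ω => addFun φ g z.1 z.2) 2 (ρ.prod P) :=
  (hφ.memLp_uncurry hφm hκ).add hg.memLp

lemma integral_sq_addFun (hg : IsApparentNoise ρ P A k xs ξ φ g m ε) (hξ : IsGaussianNoise P ξ v)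
    (hφ : IsCenteredGP P φ fun x x' => a * k x x') (hφm : Measurable fun z : X × Ω => φ z.1 z.2)
    (hκ : Integrable (fun x => a * k x x) ρ) :
    ∫ z, addFun φ g z.1 z.2 ^ 2 ∂(ρ.prod P) = ∫ x, a * k x x ∂ρ + m := by
  -- With zero weights the linear error is `φ` itself.
  have h := integral_sq_linearError_add (xs := xs) hφ hξ hg.indepFun_signal_noise hφm hκ
    (u := 0) (fun _ => MemLp.zero) hg.memLp hg.indep_signal hg.indepFun_noise
  simpa only [addFun, linearError, Pi.zero_apply, zero_mul, Finset.sum_const_zero, sub_zero,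
    linearRisk_zero, hg.second_moment] using h

/-- On `φ + g` with apparent noise `g`, the GP learner is square integrable, and its error is
close to the Bayes risk for the signal `φ` plus the second moment of `g`. -/
lemma memLp_predError_and_abs_genError_sub_le
    (hg : IsApparentNoise ρ P A k xs ξ φ g m ε) (hξ : IsGaussianNoise P ξ v)
    (hφ : IsCenteredGP P φ fun x x' => a * k x x') (hφm : Measurable fun z : X × Ω => φ z.1 z.2)
    (hκ : Integrable (fun x => a * k x x) ρ)
    (hA : A.SelectsOptimal P k v) (ha : 0 < a)
    (hk : ∀ x', Measurable fun x => k x x') :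
    MemLp (predError (addFun φ g) (A.predictor k xs ξ (addFun φ g))) 2 (ρ.prod P) ∧
    |genError ρ P (addFun φ g) (A.predictor k xs ξ (addFun φ g))
      - (∫ x, linearRisk (fun x x' => a * k x x') xs v
          (gpWeights (fun x x' => a * k x x') xs v x) x ∂ρ + m)|
      ≤ ε * (1 + (∫ x, linearRisk (fun x x' => a * k x x') xs v
          (gpWeights (fun x x' => a * k x x') xs v x) x ∂ρ + m)) + ε ^ 2 := by
  set u := gpWeights (fun x x' => a * k x x') xs v
  have hu : ∀ i, MemLp (fun x => u x i) 2 ρ := hφ.memLp_gpWeights hφm hκ xs v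
  have hW := (memLp_linearError (xs := xs) hφ hξ hφm hκ hu).add hg.memLp
  have hW2 := integral_sq_linearError_add (xs := xs) hφ hξ hg.indepFun_signal_noise hφm hκ hu
    hg.memLp hg.indep_signal hg.indepFun_noise
  rw [hg.second_moment] at hW2
  set D : X × Ω → ℝ := fun z =>
    A.predictor k xs ξ φ z.1 z.2 - A.predictor k xs ξ (addFun φ g) z.1 z.2
  have hφx : ∀ x, Measurable (φ x) := fun x => hφm.comp measurable_prodMk_left
  have hgx : ∀ x, Measurable (g x) := fun x => hg.measurable.comp measurable_prodMk_left
  have hDm : AEStronglyMeasurable D (ρ.prod P) :=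
    ((A.aemeasurable_predictor hξ hk hφx).sub
      (A.aemeasurable_predictor hξ hk fun x => (hφx x).add (hgx x))).aestronglyMeasurable
  -- The exceptional null set of outcomes does not depend on the test location, so it pulls back to
  -- a null set of the product.
  have hDε : ∀ᵐ z ∂(ρ.prod P), |D z| ≤ ε := by
    filter_upwards [Measure.quasiMeasurePreserving_snd.ae hg.indistinguishable] with z hz
    exact (hz z.1).le
  have hpred : predError (addFun φ g) (A.predictor k xs ξ (addFun φ g))
      = fun z => (linearError xs ξ φ u z + g z.1 z.2) + D z := by
    ext z
    simp only [predError, addFun, linearError, D, hA.predictor_eq ha hφ, u]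
    ring
  refine ⟨hpred ▸ hW.add (MemLp.of_bound hDm ε hDε), ?_⟩
  rw [genError, hpred, ← hW2]
  exact abs_integral_sq_add_sub_le hW hDm hDε

end IsApparentNoise

end Learner

end ResidualGP

/-! ### The limits and their comparison -/

open ResidualGP in
theorem theorem1 {X Ω : Type*} [MeasurableSpace X] [MeasurableSpace Ω]
    (ρ : Measure X) [IsProbabilityMeasure ρ] (P : Measure Ω) [IsProbabilityMeasure P]
    {n : ℕ} (xs : Fin n → X) (k : X → X → ℝ) (hk : Integrable (fun x => k x x) ρ)
    (v : ℝ≥0) (hv : 0 < v) (ξ : Fin n → Ω → ℝ) (hξ : IsGaussianNoise P ξ v)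
    (A : GPLearner X Ω n) (hA : A.SelectsOptimal P k v)
    (f : X → Ω → ℝ) (hf_meas : Measurable (fun z : X × Ω => f z.1 z.2))
    (hf : IsCenteredGP P f k)
    (α : ℝ) (hα_pos : 0 < α) (hα_le : α ≤ 1) (sg2 δ : ℝ)
    -- all of the following may depend on `ε`
    (g hNN rf rg : ℝ → X → Ω → ℝ)
    (hg : ∀ ε > 0, IsApparentNoise ρ P A k xs ξ f (g ε) sg2 ε)
    (hres : ∀ ε > 0, ∀ x ω, addFun f (g ε) x ω - hNN ε x ω = rf ε x ω + rg ε x ω)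
    (hrf_meas : ∀ ε > 0, Measurable (fun z : X × Ω => rf ε z.1 z.2))
    (hrf : ∀ ε > 0, IsCenteredGP P (rf ε) (fun x x' => α * k x x'))
    (hrg : ∀ ε > 0, IsApparentNoise ρ P A k xs ξ (rf ε) (rg ε) (sg2 - δ) ε) :
    -- the three errors are square integrable
    (∀ ε > 0,
      MemLp (predError (addFun f (g ε)) (A.predictor k xs ξ (addFun f (g ε)))) 2 (ρ.prod P) ∧
      MemLp (predError (addFun f (g ε)) (hNN ε)) 2 (ρ.prod P) ∧
      MemLp (predError (addFun f (g ε)) (residualPredictor A k xs ξ (addFun f (g ε)) (hNN ε))) 2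
        (ρ.prod P)) ∧
    (∃ L : ℝ,
      Tendsto (fun ε =>
          genError ρ P (addFun f (g ε)) (A.predictor k xs ξ (addFun f (g ε))) -
          genError ρ P (addFun f (g ε)) (residualPredictor A k xs ξ (addFun f (g ε)) (hNN ε)))
        (𝓝[>] 0) (𝓝 L) ∧ δ ≤ L) ∧
    -- strict improvement over the NN, as soon as the training locations carry some information
    -- about the signal at a non-negligible set of test locations
    ((∃ i, ¬ ∀ᵐ x ∂ρ, k x (xs i) = 0) →
      ∃ L : ℝ,
        Tendsto (fun ε =>
            genError ρ P (addFun f (g ε)) (hNN ε) -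
            genError ρ P (addFun f (g ε)) (residualPredictor A k xs ξ (addFun f (g ε)) (hNN ε)))
          (𝓝[>] 0) (𝓝 L) ∧ 0 < L) := by
  set M : ℝ → ℝ := fun a => ∫ x, linearRisk (fun x x' => a * k x x') xs v
    (gpWeights (fun x x' => a * k x x') xs v x) x ∂ρ with hM
  have hv' : (0 : ℝ) < v := NNReal.coe_pos.2 hv
  have hf1 : IsCenteredGP P f fun x x' => 1 * k x x' := by simpa only [one_mul] using hf
  have hk1 : Integrable (fun x => 1 * k x x) ρ := hk.const_mul 1
  have hkα : Integrable (fun x => α * k x x) ρ := hk.const_mul α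
  have hkm : ∀ x', Measurable fun x => k x x' := hf.measurable_kernel hf_meas
  have hGP := fun ε (hε : ε > 0) => (hg ε hε).memLp_predError_and_abs_genError_sub_le hξ hf1
    hf_meas hk1 hA one_pos hkm
  have hR := fun ε (hε : ε > 0) => (hrg ε hε).memLp_predError_and_abs_genError_sub_le hξ
    (hrf ε hε) (hrf_meas ε hε) hkα hA hα_pos hkm
  have hNN_eq : ∀ ε > 0, predError (addFun f (g ε)) (hNN ε)
      = fun z => addFun (rf ε) (rg ε) z.1 z.2 := fun ε hε => funext fun z => hres ε hε z.1 z.2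
  -- The NN prediction cancels: what remains is the error of the GP learner on the signal `r_f +
  -- r_g`.
  have hres_eq : ∀ ε > 0,
      predError (addFun f (g ε)) (residualPredictor A k xs ξ (addFun f (g ε)) (hNN ε))
        = predError (addFun (rf ε) (rg ε)) (A.predictor k xs ξ (addFun (rf ε) (rg ε))) := by
    intro ε hε
    have h : (fun x ω => addFun f (g ε) x ω - hNN ε x ω) = addFun (rf ε) (rg ε) :=
      funext fun x => funext fun ω => hres ε hε x ω
    ext z
    have hz := congrFun (congrFun h z.1) z.2
    simp only [predError, residualPredictor, h]
    rw [← hz, addFun]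
    simp only [addFun]
    ring
  have hGP_lim : Tendsto (fun ε =>
      genError ρ P (addFun f (g ε)) (A.predictor k xs ξ (addFun f (g ε))))
      (𝓝[>] 0) (𝓝 (M 1 + sg2)) := tendsto_of_abs_sub_le fun ε hε => (hGP ε hε).2
  have hR_lim : Tendsto (fun ε => genError ρ P (addFun f (g ε))
      (residualPredictor A k xs ξ (addFun f (g ε)) (hNN ε)))
      (𝓝[>] 0) (𝓝 (M α + (sg2 - δ))) := by
    refine tendsto_of_abs_sub_le fun ε hε => ?_
    rw [genError, hres_eq ε hε]
    exact (hR ε hε).2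
  have hNN_lim : Tendsto (fun ε => genError ρ P (addFun f (g ε)) (hNN ε))
      (𝓝[>] 0) (𝓝 (∫ x, α * k x x ∂ρ + (sg2 - δ))) := by
    refine tendsto_const_nhds.congr' ?_
    filter_upwards [self_mem_nhdsWithin] with ε hε
    rw [genError, hNN_eq ε hε]
    exact ((hrg ε hε).integral_sq_addFun hξ (hrf ε hε) (hrf_meas ε hε) hkα).symm
  -- The risks depend only on the kernel, not on `ε`, so the processes at the arbitrary value `ε =
  -- 1` serve as witnesses.
  have hint1 := integrable_linearRisk (xs := xs) hf1 hξ (hg 1 one_pos).indepFun_signal_noise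
    hf_meas hk1 (hf1.memLp_gpWeights hf_meas hk1 xs v)
  have hintα := integrable_linearRisk (xs := xs) (hrf 1 one_pos) hξ
    (hrg 1 one_pos).indepFun_signal_noise (hrf_meas 1 one_pos) hkα
    ((hrf 1 one_pos).memLp_gpWeights (hrf_meas 1 one_pos) hkα xs v)
  refine ⟨fun ε hε => ⟨(hGP ε hε).1, ?_, ?_⟩, ⟨_, hGP_lim.sub hR_lim, ?_⟩,
    fun ⟨i, hi⟩ => ⟨_, hNN_lim.sub hR_lim, ?_⟩⟩
  · rw [hNN_eq ε hε]
    exact (hrg ε hε).memLp_addFun (hrf ε hε) (hrf_meas ε hε) hkα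
  · rw [hres_eq ε hε]
    exact (hR ε hε).1
  -- The weights for kernel `k` compete in the problem for `α k`, where the nonnegative signal risk
  -- is multiplied by `α ≤ 1`.
  · have hle : M α ≤ M 1 := integral_mono hintα hint1 fun x =>
      ((hrf 1 one_pos).linearRisk_gpWeights_le xs hv'
        (gpWeights (fun x x' => 1 * k x x') xs v x) x).trans (by
        simp only [linearRisk, signalRisk_const_mul]
        have := hf.signalRisk_nonneg xs (gpWeights (fun x x' => 1 * k x x') xs v x) x
        gcongr)
    linarith
  · have hlt : 0 < ∫ x, (α * k x x - linearRisk (fun x x' => α * k x x') xs v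
        (gpWeights (fun x x' => α * k x x') xs v x) x) ∂ρ := by
      refine (integral_pos_iff_support_of_nonneg ?_ (hkα.sub hintα)).2 ?_
      · intro x
        have := (hrf 1 one_pos).linearRisk_gpWeights_le xs hv' 0 x
        rw [linearRisk_zero] at this
        exact sub_nonneg.2 this
      -- The gap is positive wherever `k(x, xs i) ≠ 0`, a set of positive `ρ`-measure by `hi`.
      · refine lt_of_lt_of_le (pos_iff_ne_zero.2 fun h0 => hi (ae_iff.2 h0))
          (measure_mono fun x hx => ?_)
        exact (sub_pos.2 ((hrf 1 one_pos).linearRisk_gpWeights_lt xs hv' (i := i)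
          (mul_ne_zero hα_pos.ne' hx))).ne'
    rw [integral_sub hkα hintα] at hlt
    simp only [hM]
    linarith
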